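/- Let $m\ge 3$ be an integer and let $\mathbb T$ be the set of infinite paths in the rooted $m$-regular tree, with the metric $\operatorname{dist}(x,y)=m^{-d}$ for $x\neq y$, where $d=\max\{n: x(j)=y(j)\text{ for all } j<n\}$. An atom $\omega$ of level $n$ is identified with the cylinder of all paths through it. Let $G$ be a finite commutative group with $m$ elements, with dual group $\widehat G$ written additively, and for every atom $\omega$ fix a bijection $\mathcal J_\omega$ from $G$ onto the $m$ sons of $\omega$. Let $\ell\ge 0$, let $(W_\gamma)_{\gamma\in\widehat G}$ be a family of complex linear subspaces of $\mathbb C^\ell$ (the one at $\gamma=0$ plays no role), and let $$W=\Big\{f\colon G\to\mathbb C^\ell \;\Big|\; \sum_{g\in G} f(g)=0 \text{ and } \hat f(\gamma)\in W_\gamma \text{ for all } \gamma\in\widehat G\setminus\{0\}\Big\},\qquad \hat f(\gamma)=\sum_{g\in G}\gamma(-g)f(g),$$ which is a shift-invariant space. Let $\mathcal W$ be the set of $\mathbb C^\ell$-valued (countably additive) Borel measures $\mu$ on $\mathbb T$ such that the martingale $F_n=\sum_{\omega\text{ of level }n} m^n\mu(\omega)\chi_\omega$ is bounded in $L_1$ (with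 respect to the uniform probability measure on $\mathbb T$) and, for each $n\ge 0$ and each atom $\omega$ of level $n$, the function $g\mapsto m^{n+1}\mu(\mathcal J_\omega(g))-m^n\mu(\omega)$ on $G$ belongs to $W$. Suppose that $K$ is a natural number such that for every $a\in\mathbb C^\ell\setminus\{0\}$ the set $$W^{-1}(a)=\{\gamma\in\widehat G \mid a\in W_\gamma\cap W_{-\gamma}\}$$ is contained in a subgroup of $\widehat G$ with exactly $K$ elements. Then every $\mu\in\mathcal W$ satisfies $$\dim_H\mu\;\ge\;1-\frac{\log K}{\log m},$$ where $\dim_H\mu=\inf\{\alpha \ge 0 \mid \text{there is a Borel set } F\subset\mathbb T \text{ with } \mu(F)\neq 0 \text{ and Hausdorff dimension at most } \alpha\}$ is the lower Hausdorff dimension of $\mu$ ($\inf\emptyset=\infty$, which occurs for $\mu=0$). (If $\ell=0$, then $\mu=0$ and the bound holds trivially for any $K$, with the convention $\log 0=0$.) -/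

import Mathlib

open scoped ENNReal

namespace RegularTree

/-- The boundary `𝕋` of the `m`-regular tree of atoms: infinite paths, a path being recorded by
the sequence of choices of a son. -/
@[ext]
structure TreePath (m : ℕ) : Type where
  choice : ℕ → Fin m

/-- The atoms of the `n`-th algebra of the `m`-uniform filtration: words of length `n`. -/
abbrev Atom (m n : ℕ) : Type := Fin n → Fin m

variable {m : ℕ}

/-- The set of all paths passing through an atom. -/
def pathsThrough {n : ℕ} (ω : Atom m n) : Set (TreePath m) := {x | ∀ i : Fin n, x.choice i = ω i}

/-- The `k`-th son of an atom. -/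
def son {n : ℕ} (ω : Atom m n) (k : Fin m) : Atom m (n + 1) := Fin.snoc ω k

open Classical in
/-- The distance between two different paths is `m ^ (-d)`, where `d` is the largest `n` such that
the paths agree at all positions `j < n`, that is, the first position at which they differ. -/
noncomputable def pathDist (x y : TreePath m) : ℝ :=
  if x = y then 0 else ((m : ℝ)⁻¹) ^ PiNat.firstDiff x.choice y.choice

theorem inv_natCast_le_one (m : ℕ) : ((m : ℝ)⁻¹) ≤ 1 := by
  rcases Nat.eq_zero_or_pos m with h | h
  · simp [h]
  · exact inv_le_one_of_one_le₀ (by exact_mod_cast h)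

theorem pathDist_nonneg (x y : TreePath m) : 0 ≤ pathDist x y := by
  unfold pathDist
  split_ifs
  · exact le_rfl
  · positivity

theorem pathDist_triangle (x y z : TreePath m) : pathDist x z ≤ pathDist x y + pathDist y z := by
  by_cases hxy : x = y
  · subst hxy
    simp [pathDist]
  by_cases hyz : y = z
  · subst hyz
    simp [pathDist]
  by_cases hxz : x = z
  · have h1 := pathDist_nonneg x y
    have h2 := pathDist_nonneg y z
    have h3 : pathDist x z = 0 := by simp [pathDist, hxz]
    linarith
  have hm := inv_natCast_le_one m
  have hm0 : (0 : ℝ) ≤ (m : ℝ)⁻¹ := by positivity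
  have key := PiNat.min_firstDiff_le x.choice y.choice z.choice (fun h => hxz (TreePath.ext h))
  have h1 := pathDist_nonneg x y
  have h2 := pathDist_nonneg y z
  rcases min_le_iff.1 key with h | h
  · have h3 : pathDist x z ≤ pathDist x y := by
      simp only [pathDist, hxy, hxz, if_false]
      exact pow_le_pow_of_le_one hm0 hm h
    linarith
  · have h3 : pathDist x z ≤ pathDist y z := by
      simp only [pathDist, hyz, hxz, if_false]
      exact pow_le_pow_of_le_one hm0 hm h
    linarith

theorem eq_of_pathDist_eq_zero {x y : TreePath m} (h : pathDist x y = 0) : x = y := by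
  by_contra hxy
  simp only [pathDist, hxy, if_false] at h
  have hm : 0 < m := Nat.pos_of_ne_zero (fun h0 => by subst h0; exact (x.choice 0).elim0)
  have : (0 : ℝ) < ((m : ℝ)⁻¹) ^ PiNat.firstDiff x.choice y.choice := by positivity
  linarith

noncomputable instance instMetricSpacePath : MetricSpace (TreePath m) where
  dist := pathDist
  dist_self x := by simp [pathDist]
  dist_comm x y := by
    by_cases h : x = y
    · subst h
      rfl
    · simp only [pathDist, h, Ne.symm h, if_false]
      rw [PiNat.firstDiff_comm]
  dist_triangle := pathDist_triangle
  eq_of_dist_eq_zero := eq_of_pathDist_eq_zero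

noncomputable instance instMeasurableSpacePath : MeasurableSpace (TreePath m) := borel (TreePath m)

instance instBorelSpacePath : BorelSpace (TreePath m) := ⟨rfl⟩

/-- The sequence of functions generated by a vector-valued measure by conditional expectation; the
`n`-th one is constant on the atoms of the `n`-th algebra, and its value on such an atom `ω` is the
average density `μ(ω) / m ^ (-n)`. -/
noncomputable def martingaleOf {ℓ : ℕ} (μ : MeasureTheory.VectorMeasure (TreePath m) (EuclideanSpace ℂ (Fin ℓ)))
    (n : ℕ) (ω : Atom m n) : EuclideanSpace ℂ (Fin ℓ) :=
  (m : ℂ) ^ n • μ (pathsThrough ω)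

/-- The `f_{n+1}` of a sequence `F`, restricted to the atom `ω` of the `n`-th algebra and read as a
function on `G` through the labelling `j` of the sons of `ω`. -/
def differenceOn {ℓ : ℕ} {G : Type*} (F : (n : ℕ) → Atom m n → EuclideanSpace ℂ (Fin ℓ))
    {n : ℕ} (ω : Atom m n) (j : G ≃ Fin m) : G → EuclideanSpace ℂ (Fin ℓ) :=
  fun g => F (n + 1) (son ω (j g)) - F n ω

/-- The space of `L₁`-bounded adapted sequences `F` all of whose differences lie in `W` on each
atom. If the elements of `W` have zero mean, these sequences are martingales. -/
def MartingaleSpace {ℓ : ℕ} {G : Type*}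
    (J : (n : ℕ) → Atom m n → (G ≃ Fin m)) (W : Submodule ℂ (G → EuclideanSpace ℂ (Fin ℓ))) :
    Set ((n : ℕ) → Atom m n → EuclideanSpace ℂ (Fin ℓ)) :=
  {F | (∃ C : ℝ, ∀ n : ℕ, ((m : ℝ) ^ n)⁻¹ * ∑ ω : Atom m n, ‖F n ω‖ ≤ C) ∧
    ∀ (n : ℕ) (ω : Atom m n), differenceOn F ω (J n ω) ∈ W}

/-- The lower Hausdorff dimension of a vector-valued measure: the infimum of those `α` for which
some Borel set of dimension at most `α` has nonzero measure (`∞` for the zero measure). -/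
noncomputable def lowerDimH {ℓ : ℕ} (μ : MeasureTheory.VectorMeasure (TreePath m) (EuclideanSpace ℂ (Fin ℓ))) :
    ℝ≥0∞ :=
  sInf {α : ℝ≥0∞ | ∃ F : Set (TreePath m), MeasurableSet F ∧ μ F ≠ 0 ∧ dimH F ≤ α}

/-- The Fourier coefficient at the character `γ` of a vector-valued function on a finite commutative
group. -/
noncomputable def fourierAt {ℓ : ℕ} {G : Type*} [AddCommGroup G] [Fintype G]
    (f : G → EuclideanSpace ℂ (Fin ℓ)) (γ : AddChar G ℂ) : EuclideanSpace ℂ (Fin ℓ) :=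
  ∑ x : G, γ (-x) • f x

/-- The shift invariant space of all zero-mean functions on `G` whose Fourier coefficient at each
nontrivial character `γ` lies in the prescribed subspace. The value of `Wγ` at the trivial character
plays no role. -/
noncomputable def shiftInvariantSpace {ℓ : ℕ} {G : Type*} [AddCommGroup G] [Fintype G]
    (Wγ : AddChar G ℂ → Submodule ℂ (EuclideanSpace ℂ (Fin ℓ))) :
    Submodule ℂ (G → EuclideanSpace ℂ (Fin ℓ)) where
  carrier := {f | ∑ x : G, f x = 0 ∧ ∀ γ : AddChar G ℂ, γ ≠ 0 → fourierAt f γ ∈ Wγ γ}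
  zero_mem' := by
    refine ⟨by simp, fun γ _ => ?_⟩
    simp [fourierAt]
  add_mem' := by
    rintro f g ⟨hf, hf'⟩ ⟨hg, hg'⟩
    refine ⟨by simp [Finset.sum_add_distrib, hf, hg], fun γ hγ => ?_⟩
    have h : fourierAt (f + g) γ = fourierAt f γ + fourierAt g γ := by
      simp [fourierAt, Finset.sum_add_distrib]
    rw [h]
    exact (Wγ γ).add_mem (hf' γ hγ) (hg' γ hγ)
  smul_mem' := by
    rintro c f ⟨hf, hf'⟩
    refine ⟨by simp [← Finset.smul_sum, hf], fun γ hγ => ?_⟩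
    have h : fourierAt (c • f) γ = c • fourierAt f γ := by
      simp only [fourierAt, Finset.smul_sum, Pi.smul_apply]
      exact Finset.sum_congr rfl fun x _ => smul_comm _ _ _
    rw [h]
    exact (Wγ γ).smul_mem c (hf' γ hγ)

/-- The set of characters `γ` with `a ∈ W_γ ∩ W_{-γ}`; here `-γ` is the inverse character. -/
def symmetricSupport {ℓ : ℕ} {G : Type*} [AddCommGroup G]
    (Wγ : AddChar G ℂ → Submodule ℂ (EuclideanSpace ℂ (Fin ℓ)))
    (a : EuclideanSpace ℂ (Fin ℓ)) : Set (AddChar G ℂ) :=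
  {γ | a ∈ Wγ γ ⊓ Wγ (-γ)}

end RegularTree

/-! Write `dμ = u dν` with `‖u‖ = 1` almost everywhere. Averages of `u` over the atoms through `x`
converge to `u x` for almost every `x`, so deep atoms through `x` satisfy `‖μ ω‖ ≈ ν ω`: there `μ`
is almost one-dimensional. If `‖μ ω‖ = ν ω` exactly, equality in the triangle inequality gives `μ
(son) = p • μ ω`, where `p` is the distribution of `ν` among the sons
(`eq_smul_sum_of_one_le_norm_sum`). Since `p` is real, its Fourier support is symmetric, hence lies
in a subgroup of order `K`; Fourier inversion then gives `p ≤ K / m`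
(`card_mul_le_of_mem_shiftInvariantSpace`). Compactness extends this to near equality with an error
`ε` (`exists_pos_forall_le_of_norm_sum_gt`). Thus for every `s < 1 - log K / log m`, `ν` eventually
loses a factor `m ^ (-s)` per generation along almost every path, and the mass distribution
principle (`measure_eq_zero_of_hausdorffMeasure_eq_zero`) makes `ν`, hence `μ`, vanish on Borel sets
of dimension below `s`. -/

namespace RegularTree

open MeasureTheory Filter Topology

/-! ### Polar decomposition of vector measures. -/

section PolarDecomposition

variable {X E : Type*} [MeasurableSpace X] [NormedAddCommGroup E] [NormedSpace ℝ E]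
  [FiniteDimensional ℝ E]

/-- A finite-dimensional vector measure has a density with respect to some finite measure. -/
theorem exists_eq_setIntegral (μ : VectorMeasure X E) :
    ∃ (ν : Measure X) (h : X → E), IsFiniteMeasure ν ∧ StronglyMeasurable h ∧ Integrable h ν ∧
      ∀ A, MeasurableSet A → μ A = ∫ x in A, h x ∂ν := by
  classical
  let b := Module.finBasis ℝ E
  have hb : ∀ i, Continuous (b.coord i) := fun i => LinearMap.continuous_of_finiteDimensional _
  let s : Fin (Module.finrank ℝ E) → SignedMeasure X :=
    fun i => μ.mapRange (b.coord i).toAddMonoidHom (hb i)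
  -- This sum dominates every coordinate of `μ`, so Radon–Nikodym applies coordinatewise.
  let ν : Measure X := ∑ i, (s i).totalVariation
  have hfin : ∀ i, IsFiniteMeasure (s i).totalVariation := fun i => by
    unfold SignedMeasure.totalVariation; infer_instance
  have hν : IsFiniteMeasure ν := by
    refine ⟨?_⟩
    simp only [ν, Measure.finsetSum_apply]
    exact ENNReal.sum_lt_top.2 fun i _ => measure_lt_top _ _
  have hac : ∀ i, s i ≪ᵥ ν.toENNRealVectorMeasure := fun i => by
    refine VectorMeasure.AbsolutelyContinuous.mk fun A hA h0 => ?_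
    rw [Measure.toENNRealVectorMeasure_apply_measurable hA, Measure.finsetSum_apply,
      Finset.sum_eq_zero_iff] at h0
    have h1 := SignedMeasure.enorm_le_totalVariation (s i) A
    rw [h0 i (Finset.mem_univ i)] at h1
    simpa using h1
  have hint : ∀ i, Integrable (fun x => (s i).rnDeriv ν x • b i) ν := fun i =>
    (SignedMeasure.integrable_rnDeriv (s i) ν).smul_const (b i)
  refine ⟨ν, fun x => ∑ i, (s i).rnDeriv ν x • b i, hν, ?_, integrable_finsetSum _ fun i _ => hint i,
    fun A hA => ?_⟩
  · refine Finset.stronglyMeasurable_fun_sum _ fun i _ => ?_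
    exact (SignedMeasure.measurable_rnDeriv (s i) ν).stronglyMeasurable.smul_const (b i)
  · rw [integral_finsetSum _ fun i _ => (hint i).integrableOn, ← b.sum_repr (μ A)]
    refine Finset.sum_congr rfl fun i _ => ?_
    rw [integral_smul_const, ← withDensityᵥ_apply (SignedMeasure.integrable_rnDeriv (s i) ν) hA,
      SignedMeasure.withDensityᵥ_rnDeriv_eq _ _ (hac i)]
    rfl

/-- Polar decomposition of a finite-dimensional vector measure. -/
theorem exists_polar_decomposition (μ : VectorMeasure X E) :
    ∃ (ν : Measure X) (u : X → E), IsFiniteMeasure ν ∧ StronglyMeasurable u ∧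
      (∀ᵐ x ∂ν, ‖u x‖ = 1) ∧ ∀ A, MeasurableSet A → μ A = ∫ x in A, u x ∂ν := by
  obtain ⟨ν, h, hν, hm, hi, hμ⟩ := exists_eq_setIntegral μ
  have hnm : Measurable fun x => ‖h x‖₊ := hm.nnnorm.measurable
  -- Where `h = 0` the direction takes the default value `0`, but the new measure does not charge
  -- that set.
  refine ⟨ν.withDensity fun x => ‖h x‖₊, fun x => ‖h x‖⁻¹ • h x, ?_, ?_, ?_, fun A hA => ?_⟩
  · exact isFiniteMeasure_withDensity hi.2.ne
  · exact (hm.norm.measurable.inv.stronglyMeasurable).smul hm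
  · rw [ae_withDensity_iff hnm.coe_nnreal_ennreal]
    refine ae_of_all _ fun x hx => ?_
    have hx' : ‖h x‖ ≠ 0 := by simpa using hx
    rw [norm_smul, norm_inv, norm_norm, inv_mul_cancel₀ hx']
  · rw [hμ A hA, setIntegral_withDensity_eq_setIntegral_smul hnm _ hA]
    refine integral_congr_ae (ae_of_all _ fun x => ?_)
    by_cases hx : h x = 0
    · simp [hx]
    · simp [NNReal.smul_def, smul_smul, hx]

end PolarDecomposition

/-! ### Atoms as balls, and martingale differentiation. -/

section Cylinders

variable {m : ℕ}

/-- The atom of level `n` through which a path passes. -/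
def initialAtom (n : ℕ) (x : TreePath m) : Atom m n := fun i => x.choice i

theorem mem_pathsThrough {n : ℕ} {ω : Atom m n} {x : TreePath m} :
    x ∈ pathsThrough ω ↔ initialAtom n x = ω := funext_iff.symm

theorem mem_pathsThrough_initialAtom (n : ℕ) (x : TreePath m) :
    x ∈ pathsThrough (initialAtom n x) := mem_pathsThrough.2 rfl

theorem initialAtom_succ (n : ℕ) (x : TreePath m) :
    initialAtom (n + 1) x = son (initialAtom n x) (x.choice n) := by
  funext i
  refine Fin.lastCases ?_ (fun i => ?_) i
  · simp [son, initialAtom]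
  · simp [son, initialAtom]

theorem initialAtom_eq_son_iff {n : ℕ} {ω : Atom m n} {k : Fin m} {x : TreePath m} :
    initialAtom (n + 1) x = son ω k ↔ initialAtom n x = ω ∧ x.choice n = k := by
  rw [initialAtom_succ]
  exact Fin.snoc_inj

theorem iUnion_pathsThrough_son {n : ℕ} (ω : Atom m n) :
    ⋃ k, pathsThrough (son ω k) = pathsThrough ω := by
  ext x
  simp [mem_pathsThrough, initialAtom_eq_son_iff]

theorem disjoint_pathsThrough {n : ℕ} {ω ω' : Atom m n} (h : ω ≠ ω') :
    Disjoint (pathsThrough ω) (pathsThrough ω') :=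
  Set.disjoint_left.2 fun _ hx hx' => h ((mem_pathsThrough.1 hx).symm.trans (mem_pathsThrough.1 hx'))

theorem son_injective {n : ℕ} (ω : Atom m n) : Function.Injective (son ω) :=
  fun _ _ h => (Fin.snoc_inj.1 h).2

theorem dist_le_pow_iff (hm : 2 ≤ m) {n : ℕ} {x y : TreePath m} :
    dist y x ≤ ((m : ℝ)⁻¹) ^ n ↔ y ∈ pathsThrough (initialAtom n x) := by
  have hm' : (1 : ℝ) < m := by exact_mod_cast hm
  change pathDist y x ≤ _ ↔ _
  unfold pathDist
  split_ifs with h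
  · subst h
    exact iff_of_true (by positivity) (mem_pathsThrough_initialAtom n y)
  · rw [pow_le_pow_iff_right_of_lt_one₀ (by positivity) (inv_lt_one_of_one_lt₀ hm')]
    refine ⟨fun hn i => PiNat.apply_eq_of_lt_firstDiff (i.2.trans_le hn), fun hn => ?_⟩
    by_contra! hlt
    exact PiNat.apply_firstDiff_ne (fun hc => h (TreePath.ext hc)) (hn ⟨_, hlt⟩)

theorem pathsThrough_initialAtom_eq_closedBall (hm : 2 ≤ m) (n : ℕ) (x : TreePath m) :
    pathsThrough (initialAtom n x) = Metric.closedBall x (((m : ℝ)⁻¹) ^ n) :=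
  Set.ext fun _ => (dist_le_pow_iff hm).symm

theorem measurableSet_pathsThrough (hm : 2 ≤ m) {n : ℕ} (ω : Atom m n) :
    MeasurableSet (pathsThrough ω) := by
  rcases (pathsThrough ω).eq_empty_or_nonempty with h | ⟨x, hx⟩
  · rw [h]; exact MeasurableSet.empty
  · rw [← mem_pathsThrough.1 hx, pathsThrough_initialAtom_eq_closedBall hm]
    exact Metric.isClosed_closedBall.measurableSet

theorem measurable_initialAtom (hm : 2 ≤ m) (n : ℕ) :
    Measurable (initialAtom n : TreePath m → Atom m n) := by
  refine measurable_to_countable' fun ω => ?_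
  convert measurableSet_pathsThrough hm ω using 1
  ext x
  simp [mem_pathsThrough]

/-- The filtration generated by the atoms. -/
def atomFiltration (hm : 2 ≤ m) :
    Filtration ℕ (inferInstance : MeasurableSpace (TreePath m)) where
  seq n := MeasurableSpace.comap (initialAtom n) inferInstance
  mono' := by
    refine monotone_nat_of_le_succ fun n => ?_
    have h : (initialAtom n : TreePath m → Atom m n) = Fin.init ∘ initialAtom (n + 1) := rfl
    rw [h, ← MeasurableSpace.comap_comp]
    exact MeasurableSpace.comap_mono (measurable_of_finite _).comap_le
  le' n := (measurable_initialAtom hm n).comap_le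

theorem measurableSet_atomFiltration_pathsThrough (hm : 2 ≤ m) {n : ℕ} (ω : Atom m n) :
    MeasurableSet[atomFiltration hm n] (pathsThrough ω) :=
  ⟨{ω}, MeasurableSet.singleton _, by ext x; simp [mem_pathsThrough]⟩

/-- Every open set is the countable union of the atoms it contains. With this, Lévy's upward theorem
has limit `f` itself. -/
theorem iSup_atomFiltration (hm : 2 ≤ m) :
    ⨆ n, atomFiltration hm n = (inferInstance : MeasurableSpace (TreePath m)) := by
  refine le_antisymm (iSup_le fun n => (atomFiltration hm).le n) ?_
  refine MeasurableSpace.generateFrom_le fun U (hU : IsOpen U) => ?_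
  have hU' : U = ⋃ (n : ℕ) (ω : Atom m n) (_ : pathsThrough ω ⊆ U), pathsThrough ω := by
    ext x
    simp only [Set.mem_iUnion, exists_prop]
    refine ⟨fun hx => ?_, fun ⟨n, ω, h, hx⟩ => h hx⟩
    obtain ⟨r, hr, hball⟩ := Metric.isOpen_iff.1 hU x hx
    have hm' : (1 : ℝ) < m := by exact_mod_cast hm
    obtain ⟨n, hn⟩ := exists_pow_lt_of_lt_one hr (inv_lt_one_of_one_lt₀ hm')
    refine ⟨n, initialAtom n x, fun y hy => hball ?_, mem_pathsThrough_initialAtom n x⟩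
    exact ((dist_le_pow_iff hm).2 hy).trans_lt hn
  rw [hU']
  refine MeasurableSet.iUnion fun n => MeasurableSet.iUnion fun ω => MeasurableSet.iUnion fun _ => ?_
  exact le_iSup (fun n => atomFiltration hm n) n _ (measurableSet_atomFiltration_pathsThrough hm ω)

/-- The conditional expectation is constant on each atom. The product form also covers null atoms,
where no average exists. -/
theorem condExp_atomFiltration_mul (hm : 2 ≤ m) (ν : Measure (TreePath m)) [IsFiniteMeasure ν]
    {f : TreePath m → ℝ} (hf : Integrable f ν) (n : ℕ) (x : TreePath m) :
    (ν[f | atomFiltration hm n]) x * ν.real (pathsThrough (initialAtom n x)) =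
      ∫ y in pathsThrough (initialAtom n x), f y ∂ν := by
  rw [← setIntegral_condExp ((atomFiltration hm).le n) hf
    (measurableSet_atomFiltration_pathsThrough hm _)]
  have hfac : Function.FactorsThrough (ν[f | atomFiltration hm n]) (initialAtom n) :=
    StronglyMeasurable.factorsThrough (stronglyMeasurable_condExp (μ := ν) (f := f))
  rw [setIntegral_congr_fun (g := fun _ => (ν[f | atomFiltration hm n]) x)
    (measurableSet_pathsThrough hm _) fun y hy => hfac (mem_pathsThrough.1 hy)]
  simp [mul_comm]

theorem exists_tendsto_average_atoms_real (hm : 2 ≤ m) (ν : Measure (TreePath m))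
    [IsFiniteMeasure ν] {f : TreePath m → ℝ} (hf : Integrable f ν) :
    ∀ᵐ x ∂ν, ∃ c : ℕ → ℝ, Tendsto c atTop (𝓝 (f x)) ∧
      ∀ n, c n * ν.real (pathsThrough (initialAtom n x)) =
        ∫ y in pathsThrough (initialAtom n x), f y ∂ν := by
  have h1 := tendsto_ae_condExp (μ := ν) (ℱ := atomFiltration hm) f
  rw [iSup_atomFiltration hm] at h1
  filter_upwards [h1, condExp_of_aestronglyMeasurable' le_rfl hf.1 hf] with x hx hx'
  rw [hx'] at hx
  exact ⟨_, hx, fun n => condExp_atomFiltration_mul hm ν hf n x⟩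

/-- Differentiation along the atoms: the averages of an integrable function converge to it. -/
theorem exists_tendsto_average_atoms {E : Type*} [NormedAddCommGroup E] [NormedSpace ℝ E]
    [FiniteDimensional ℝ E] (hm : 2 ≤ m) (ν : Measure (TreePath m)) [IsFiniteMeasure ν]
    {u : TreePath m → E} (hu : Integrable u ν) :
    ∀ᵐ x ∂ν, ∃ c : ℕ → E, Tendsto c atTop (𝓝 (u x)) ∧
      ∀ n, ν.real (pathsThrough (initialAtom n x)) • c n =
        ∫ y in pathsThrough (initialAtom n x), u y ∂ν := by
  let b := Module.finBasis ℝ E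
  let φ : Fin (Module.finrank ℝ E) → E →L[ℝ] ℝ := fun i => LinearMap.toContinuousLinearMap (b.coord i)
  have hφ : ∀ v, ∑ i, φ i v • b i = v := fun v => b.sum_repr v
  have h := ae_all_iff.2 fun i =>
    exists_tendsto_average_atoms_real hm ν ((φ i).integrable_comp hu)
  filter_upwards [h] with x hx
  choose c hc hc' using hx
  refine ⟨fun n => ∑ i, c i n • b i, ?_, fun n => ?_⟩
  · rw [← hφ (u x)]
    exact tendsto_finsetSum _ fun i _ => (hc i).smul_const _
  · rw [Finset.smul_sum, ← hφ (∫ y in _, u y ∂ν)]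
    refine Finset.sum_congr rfl fun i _ => ?_
    rw [smul_smul, mul_comm, hc' i n, (φ i).integral_comp_comm hu.integrableOn]

end Cylinders

/-! ### Fourier bound in the exactly one-dimensional case. -/

section Fourier

variable {ℓ : ℕ} {G : Type*} [AddCommGroup G] [Fintype G]

theorem card_smul_eq_sum_fourier (f : G → ℂ) (g : G) :
    (Fintype.card G : ℂ) * f g = ∑ γ : AddChar G ℂ, (∑ x, γ (-x) * f x) * γ g := by
  classical
  simp_rw [Finset.sum_mul]
  rw [Finset.sum_comm]
  have h : ∀ x, ∑ γ : AddChar G ℂ, γ (-x) * f x * γ g =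
      (if x = g then (Fintype.card G : ℂ) else 0) * f x := fun x => by
    have h' : ∑ γ : AddChar G ℂ, γ (g - x) = if x = g then (Fintype.card G : ℂ) else 0 := by
      rw [AddChar.sum_apply_eq_ite]
      exact if_congr (sub_eq_zero.trans eq_comm) rfl rfl
    rw [← h', Finset.sum_mul]
    refine Finset.sum_congr rfl fun γ _ => ?_
    rw [sub_eq_add_neg, AddChar.map_add_eq_mul]
    ring
  simp [h]

/-- A probability distribution `p` on `G` for which the one-dimensional difference `(|G| p - 1) a`
lies in the shift invariant space has atoms of mass at most `K / |G|`. -/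
theorem card_mul_le_of_mem_shiftInvariantSpace
    {Wγ : AddChar G ℂ → Submodule ℂ (EuclideanSpace ℂ (Fin ℓ))} {a : EuclideanSpace ℂ (Fin ℓ)}
    (H : AddSubgroup (AddChar G ℂ)) (hH : symmetricSupport Wγ a ⊆ (H : Set (AddChar G ℂ)))
    {p : G → ℝ} (hp : ∀ g, 0 ≤ p g) (hp1 : ∑ g, p g = 1)
    (hW : (fun g => (Fintype.card G : ℂ) • ((p g : ℂ) • a) - a) ∈ shiftInvariantSpace Wγ) (g : G) :
    Fintype.card G * p g ≤ Nat.card H := by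
  classical
  let q : AddChar G ℂ → ℂ := fun γ => ∑ x, γ (-x) * p x
  have hcard : (Fintype.card G : ℂ) ≠ 0 := Nat.cast_ne_zero.2 Fintype.card_ne_zero
  -- At nontrivial `γ` the constant `-a` contributes nothing, so the coefficient is a multiple of
  -- `a`.
  have hmem : ∀ γ, γ ≠ 0 → q γ ≠ 0 → a ∈ Wγ γ := fun γ hγ hq => by
    have h1 := hW.2 γ hγ
    have h0 : ∑ x, γ (-x) = 0 := by
      rw [← AddChar.sum_eq_zero_iff_ne_zero.2 hγ]
      exact Fintype.sum_equiv (Equiv.neg G) _ _ fun x => rfl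
    have h2 : fourierAt (fun g => (Fintype.card G : ℂ) • ((p g : ℂ) • a) - a) γ =
        ((Fintype.card G : ℂ) * q γ) • a := by
      simp only [fourierAt, smul_sub, Finset.sum_sub_distrib, smul_smul]
      rw [← Finset.sum_smul, ← Finset.sum_smul, h0, zero_smul, sub_zero, Finset.mul_sum]
      congr 1
      exact Finset.sum_congr rfl fun x _ => by ring
    rw [h2] at h1
    exact ((Wγ γ).smul_mem_iff (mul_ne_zero hcard hq)).1 h1
  -- Since `p` is real, `q` vanishes at `γ` and `-γ` simultaneously; this is why only `W_γ ∩ W_{-γ}`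
  -- matters.
  have hconj : ∀ γ, q (-γ) = (starRingEnd ℂ) (q γ) := fun γ => by
    simp only [q, map_sum, map_mul, Complex.conj_ofReal]
    refine Finset.sum_congr rfl fun x _ => ?_
    rw [← AddChar.map_neg_eq_conj, AddChar.neg_apply]
  have hq0 : ∀ γ, γ ∉ H → q γ = 0 := fun γ hγ => by
    by_contra hq
    have hγ0 : γ ≠ 0 := fun h => hγ (h ▸ H.zero_mem)
    refine hγ (hH ⟨hmem γ hγ0 hq, hmem (-γ) (neg_ne_zero.2 hγ0) ?_⟩)
    rw [hconj]
    exact (map_ne_zero _).2 hq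
  have hq1 : ∀ γ, ‖q γ‖ ≤ 1 := fun γ => by
    rw [← hp1]
    refine (norm_sum_le _ _).trans (Finset.sum_le_sum fun x _ => ?_)
    simp [abs_of_nonneg (hp x)]
  have hinv := card_smul_eq_sum_fourier (fun x => (p x : ℂ)) g
  calc (Fintype.card G : ℝ) * p g = ‖(Fintype.card G : ℂ) * (p g : ℂ)‖ := by
        simp [abs_of_nonneg (hp g)]
    _ ≤ ∑ γ : AddChar G ℂ, ‖q γ * γ g‖ := by rw [hinv]; exact norm_sum_le _ _
    _ ≤ ∑ γ : AddChar G ℂ, if γ ∈ H then 1 else 0 := by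
        refine Finset.sum_le_sum fun γ _ => ?_
        split_ifs with h
        · simpa using hq1 γ
        · simp [hq0 γ h]
    _ = Nat.card H := by
        rw [Finset.sum_boole, Nat.card_eq_fintype_card, Fintype.card_subtype]

end Fourier

/-- In an inner product space, equality in the triangle inequality forces proportionality. -/
theorem eq_smul_sum_of_one_le_norm_sum {ι E : Type*} [Fintype ι] [NormedAddCommGroup E]
    [InnerProductSpace ℂ E] {v : ι → E} {p : ι → ℝ} (hv : ∀ i, ‖v i‖ ≤ p i) (hp : ∑ i, p i = 1)
    (h1 : 1 ≤ ‖∑ i, v i‖) (i : ι) : v i = (p i : ℂ) • ∑ j, v j := by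
  set a := ∑ j, v j with ha
  have hale : ‖a‖ ≤ 1 := (norm_sum_le _ _).trans ((Finset.sum_le_sum fun i _ => hv i).trans hp.le)
  have ha1 : ‖a‖ = 1 := le_antisymm hale h1
  have hle : ∀ j ∈ Finset.univ, RCLike.re (inner ℂ a (v j)) ≤ p j := fun j _ =>
    (re_inner_le_norm a (v j)).trans (by rw [ha1, one_mul]; exact hv j)
  -- Both sums equal `1`, so the termwise inequalities `hle` are equalities.
  have hsum : ∑ j, RCLike.re (inner ℂ a (v j)) = ∑ j, p j := by
    rw [← map_sum, ← inner_sum, ← ha, hp, inner_self_eq_norm_sq, ha1, one_pow]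
  have heq := (Finset.sum_eq_sum_iff_of_le hle).1 hsum i (Finset.mem_univ i)
  rw [← sub_eq_zero, ← norm_eq_zero, ← sq_eq_zero_iff]
  refine le_antisymm ?_ (sq_nonneg _)
  have h3 := norm_sub_sq (𝕜 := ℂ) (v i) ((p i : ℂ) • a)
  have hp0 : 0 ≤ p i := (norm_nonneg _).trans (hv i)
  rw [h3, inner_smul_right, norm_smul, ha1]
  have h4 : RCLike.re ((p i : ℂ) * inner ℂ (v i) a) = p i * p i := by
    rw [inner_re_symm] at heq
    exact (Complex.re_ofReal_mul _ _).trans (congrArg _ heq)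
  rw [h4]
  have h5 : ‖v i‖ ^ 2 ≤ p i ^ 2 := pow_le_pow_left₀ (norm_nonneg _) (hv i) 2
  have h6 : ‖(p i : ℂ)‖ = p i := by simp [abs_of_nonneg hp0]
  rw [h6]
  -- `‖v i - p i • a‖² ≤ p i² - 2 p i² + p i² = 0`.
  nlinarith

/-! ### Compactness: from exact to approximate one-dimensionality. -/

section Stability

variable {ℓ : ℕ} {G : Type*} [AddCommGroup G] [Fintype G]

/-- Stability of `card_mul_le_of_mem_shiftInvariantSpace` for almost one-dimensional differences. -/
theorem exists_pos_forall_le_of_norm_sum_gt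
    {Wγ : AddChar G ℂ → Submodule ℂ (EuclideanSpace ℂ (Fin ℓ))} {K : ℕ}
    (hK : ∀ a : EuclideanSpace ℂ (Fin ℓ), a ≠ 0 →
      ∃ H : AddSubgroup (AddChar G ℂ), Nat.card H = K ∧
        symmetricSupport Wγ a ⊆ (H : Set (AddChar G ℂ))) {ε : ℝ} (hε : 0 < ε) :
    ∃ δ > 0, ∀ (v : G → EuclideanSpace ℂ (Fin ℓ)) (p : G → ℝ), (∀ g, ‖v g‖ ≤ p g) →
      ∑ g, p g = 1 →
      (fun g => (Fintype.card G : ℂ) • v g - ∑ x, v x) ∈ shiftInvariantSpace Wγ →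
      1 - δ < ‖∑ g, v g‖ → ∀ g, p g ≤ K / Fintype.card G + ε := by
  -- The configurations violating the bound, with a non-strict inequality to make `S` closed. The
  -- norm of the sum is below `1` on this compact set, so its maximum provides `δ`.
  let S : Set ((G → EuclideanSpace ℂ (Fin ℓ)) × (G → ℝ)) :=
    {z | (∀ g, ‖z.1 g‖ ≤ z.2 g) ∧ ∑ g, z.2 g = 1 ∧
      (fun g => (Fintype.card G : ℂ) • z.1 g - ∑ x, z.1 x) ∈ shiftInvariantSpace Wγ ∧
      ∃ g, K / Fintype.card G + ε ≤ z.2 g}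
  have hclosed : IsClosed S := by
    refine IsClosed.and ?_ (IsClosed.and ?_ (IsClosed.and ?_ ?_))
    · simp only [Set.ofPred_forall]
      exact isClosed_iInter fun g => isClosed_le (by fun_prop) (by fun_prop)
    · exact isClosed_eq (by fun_prop) continuous_const
    · exact (Submodule.closed_of_finiteDimensional (shiftInvariantSpace Wγ)).preimage
        (by fun_prop : Continuous fun z : (G → EuclideanSpace ℂ (Fin ℓ)) × (G → ℝ) =>
          fun g => (Fintype.card G : ℂ) • z.1 g - ∑ x, z.1 x)
    · simp only [Set.ofPred_exists]
      exact isClosed_iUnion_of_finite fun g => isClosed_le continuous_const (by fun_prop)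
  have hbdd : S ⊆ Metric.closedBall 0 1 := by
    rintro ⟨v, p⟩ ⟨hv, hp, -, -⟩
    have hp0 : ∀ g, 0 ≤ p g := fun g => (norm_nonneg _).trans (hv g)
    have hp1 : ∀ g, p g ≤ 1 := fun g => by
      rw [← hp]
      exact Finset.single_le_sum (fun i _ => hp0 i) (Finset.mem_univ g)
    rw [mem_closedBall_zero_iff, Prod.norm_def, max_le_iff, pi_norm_le_iff_of_nonneg zero_le_one,
      pi_norm_le_iff_of_nonneg zero_le_one]
    exact ⟨fun g => (hv g).trans (hp1 g), fun g => by
      rw [Real.norm_of_nonneg (hp0 g)]; exact hp1 g⟩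
  have hcomp : IsCompact S := (isCompact_closedBall _ _).of_isClosed_subset hclosed hbdd
  have hlt : ∀ z ∈ S, ‖∑ g, z.1 g‖ < 1 := by
    rintro ⟨v, p⟩ ⟨hv, hp, hW, g, hg⟩
    by_contra! h1
    have hpos : 0 < (Fintype.card G : ℝ) := Nat.cast_pos.2 Fintype.card_pos
    have hprop := eq_smul_sum_of_one_le_norm_sum hv hp h1
    have ha : ∑ x, v x ≠ 0 := fun h => by simp [h] at h1; linarith
    obtain ⟨H, hHK, hH⟩ := hK _ ha
    have hW' : (fun g => (Fintype.card G : ℂ) • ((p g : ℂ) • ∑ x, v x) - ∑ x, v x) ∈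
        shiftInvariantSpace Wγ := by
      simp_rw [← hprop]
      exact hW
    have h2 := card_mul_le_of_mem_shiftInvariantSpace H hH
      (fun g => (norm_nonneg _).trans (hv g)) hp hW' g
    rw [hHK, mul_comm, ← le_div_iff₀ hpos] at h2
    simp only at hg
    linarith
  rcases S.eq_empty_or_nonempty with hS | hS
  · refine ⟨1, one_pos, fun v p hv hp hW _ g => ?_⟩
    by_contra! hlt
    have : (v, p) ∈ S := ⟨hv, hp, hW, g, hlt.le⟩
    simp [hS] at this
  · obtain ⟨z, hz, hmax⟩ := hcomp.exists_isMaxOn hS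
      (f := fun z => ‖∑ g, z.1 g‖) (by fun_prop)
    refine ⟨1 - ‖∑ g, z.1 g‖, sub_pos.2 (hlt z hz), fun v p hv hp hW hn g => ?_⟩
    by_contra! hlt
    have := hmax (show (v, p) ∈ S from ⟨hv, hp, hW, g, hlt.le⟩)
    simp only [Set.mem_ofPred_eq] at this
    linarith

end Stability

/-! ### Mass decay along paths and Hausdorff measure. -/

section Mass

variable {m : ℕ}

theorem sum_measureReal_pathsThrough_son (hm : 2 ≤ m) (ν : Measure (TreePath m))
    [IsFiniteMeasure ν] {n : ℕ} (ω : Atom m n) :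
    ∑ k, ν.real (pathsThrough (son ω k)) = ν.real (pathsThrough ω) := by
  rw [← iUnion_pathsThrough_son ω, measureReal_iUnion_fintype
    (fun _ _ h => disjoint_pathsThrough ((son_injective ω).ne h))
    fun _ => measurableSet_pathsThrough hm _]

theorem sum_vectorMeasure_pathsThrough_son {E : Type*} [AddCommMonoid E] [TopologicalSpace E]
    [T2Space E] (hm : 2 ≤ m) (μ : VectorMeasure (TreePath m) E) {n : ℕ} (ω : Atom m n) :
    ∑ k, μ (pathsThrough (son ω k)) = μ (pathsThrough ω) := by
  rw [← iUnion_pathsThrough_son ω, μ.of_disjoint_iUnion (fun _ => measurableSet_pathsThrough hm _)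
    (fun _ _ h => disjoint_pathsThrough ((son_injective ω).ne h)), tsum_fintype]

/-- A measure which loses a factor `m ^ (-s)` at each generation along the paths of a set `A` is
dominated on `A` by the `s`-dimensional Hausdorff measure. -/
theorem measure_eq_zero_of_hausdorffMeasure_eq_zero (hm : 2 ≤ m) (ν : Measure (TreePath m))
    [IsFiniteMeasure ν] {A : Set (TreePath m)} (hA : MeasurableSet A) {s : ℝ} (hs : 0 < s) (N : ℕ)
    (hdecay : ∀ x ∈ A, ∀ n ≥ N, ν.real (pathsThrough (initialAtom (n + 1) x)) ≤
      (m : ℝ) ^ (-s) * ν.real (pathsThrough (initialAtom n x)))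
    (h0 : μH[s] A = 0) : ν A = 0 := by
  have hm' : (1 : ℝ) < m := by exact_mod_cast hm
  have hm0 : (0 : ℝ) < m := by positivity
  have hinv0 : (0 : ℝ) < (m : ℝ)⁻¹ := by positivity
  have hinv1 : (m : ℝ)⁻¹ < 1 := inv_lt_one_of_one_lt₀ hm'
  set r : ℝ := (m : ℝ) ^ (-s) with hr
  have hr0 : 0 < r := Real.rpow_pos_of_pos hm0 _
  have hr1 : r < 1 := Real.rpow_lt_one_of_one_lt_of_neg hm' (neg_lt_zero.2 hs)
  have hrpow : ∀ n : ℕ, (((m : ℝ)⁻¹) ^ n) ^ s = r ^ n := fun n => by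
    rw [hr, Real.rpow_neg hm0.le, ← Real.inv_rpow hm0.le, ← Real.rpow_natCast, ← Real.rpow_natCast,
      ← Real.rpow_mul hinv0.le, ← Real.rpow_mul hinv0.le, mul_comm]
  -- Dividing by `r ^ N` makes the bound hold at level `N`; the `+ 1` keeps `C` positive when `ν =
  -- 0`.
  set C : ℝ := (ν.real Set.univ + 1) / r ^ N with hC
  have hC0 : 0 < C := by positivity
  have hmass : ∀ x ∈ A, ∀ n ≥ N, ν.real (pathsThrough (initialAtom n x)) ≤ C * r ^ n := by
    intro x hx n hn
    induction n, hn using Nat.le_induction with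
    | base =>
      rw [hC, div_mul_cancel₀ _ (by positivity)]
      exact (measureReal_mono (Set.subset_univ _)).trans (by linarith)
    | succ n hn ih =>
      calc _ ≤ r * ν.real (pathsThrough (initialAtom n x)) := hdecay x hx n hn
        _ ≤ r * (C * r ^ n) := by gcongr
        _ = C * r ^ (n + 1) := by ring
  have hkey : ENNReal.ofReal (r / C) • ν.restrict A ≤ μH[s] := by
    refine Measure.le_hausdorffMeasure s _ (ENNReal.ofReal (((m : ℝ)⁻¹) ^ N))
      (by rw [ENNReal.ofReal_pos]; positivity) fun B hB => ?_
    rw [Measure.smul_apply, Measure.restrict_apply' hA, smul_eq_mul]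
    rcases (B ∩ A).eq_empty_or_nonempty with hE | ⟨x, hxB, hxA⟩
    · simp [hE]
    have hBfin : Metric.ediam B ≠ ∞ := (hB.trans_lt ENNReal.ofReal_lt_top).ne
    obtain ⟨d, hd0, hd⟩ : ∃ d : ℝ, 0 ≤ d ∧ Metric.ediam B = ENNReal.ofReal d :=
      ⟨_, ENNReal.toReal_nonneg, (ENNReal.ofReal_toReal hBfin).symm⟩
    have hdist : ∀ y ∈ B, dist y x ≤ d := fun y hy => by
      have := Metric.edist_le_ediam_of_mem hy hxB
      rwa [hd, edist_dist, ENNReal.ofReal_le_ofReal_iff hd0] at this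
    have hdN : d ≤ ((m : ℝ)⁻¹) ^ N := by
      rwa [hd, ENNReal.ofReal_le_ofReal_iff (by positivity)] at hB
    have hle : ∀ n ≥ N, d ≤ ((m : ℝ)⁻¹) ^ n → ν (B ∩ A) ≤ ENNReal.ofReal (C * r ^ n) := by
      intro n hn hdn
      refine (measure_mono (fun y hy => (dist_le_pow_iff hm).1 ((hdist y hy.1).trans hdn))).trans ?_
      rw [← ofReal_measureReal]
      exact ENNReal.ofReal_le_ofReal (hmass x hxA n hn)
    -- At zero diameter no scale matches `d`, but `B ∩ A` lies in atoms of every level and their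
    -- masses tend to `0`.
    rcases hd0.eq_or_lt with h | hdpos
    · have hlim : Tendsto (fun n : ℕ => ENNReal.ofReal (C * r ^ n)) atTop (𝓝 0) := by
        rw [← ENNReal.ofReal_zero]
        refine ENNReal.tendsto_ofReal ?_
        simpa using (tendsto_pow_atTop_nhds_zero_of_lt_one hr0.le hr1).const_mul C
      have hz : ν (B ∩ A) ≤ 0 := ge_of_tendsto hlim <| by
        filter_upwards [eventually_ge_atTop N] with n hn
        exact hle n hn (h ▸ by positivity)
      rw [nonpos_iff_eq_zero.1 hz, mul_zero]
      exact zero_le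
    -- Here `m ^ (-(n+1)) < d ≤ m ^ (-n)`; the mismatch of one generation costs the factor `r` in `r
    -- / C`.
    · obtain ⟨n, hn1, hn2⟩ := exists_nat_pow_near_of_lt_one hdpos
        (hdN.trans (pow_le_one₀ hinv0.le hinv1.le)) hinv0 hinv1
      have hnN : N ≤ n := Nat.lt_succ_iff.1
        ((pow_lt_pow_iff_right_of_lt_one₀ hinv0 hinv1).1 (hn1.trans_le hdN))
      rw [hd, ENNReal.ofReal_rpow_of_nonneg hd0 hs.le]
      refine (mul_le_mul_right (hle n hnN hn2) _).trans ?_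
      rw [← ENNReal.ofReal_mul (by positivity)]
      refine ENNReal.ofReal_le_ofReal ?_
      calc r / C * (C * r ^ n) = r ^ (n + 1) := by field_simp; ring
        _ = (((m : ℝ)⁻¹) ^ (n + 1)) ^ s := (hrpow _).symm
        _ ≤ d ^ s := Real.rpow_le_rpow (by positivity) hn1.le hs.le
  have h1 := hkey A
  rw [h0, Measure.smul_apply, Measure.restrict_apply_self, smul_eq_mul, nonpos_iff_eq_zero,
    mul_eq_zero, ENNReal.ofReal_eq_zero] at h1
  exact h1.resolve_left (not_le.2 (by positivity))

/-- On an atom where `μ` is almost one-dimensional, the mass of each son is at most about `K / m`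
times the mass of the atom. -/
theorem exists_pos_forall_measureReal_son_le (hm : 2 ≤ m) {ℓ : ℕ} {G : Type*} [AddCommGroup G]
    [Fintype G] {J : (n : ℕ) → Atom m n → (G ≃ Fin m)}
    {Wγ : AddChar G ℂ → Submodule ℂ (EuclideanSpace ℂ (Fin ℓ))} {K : ℕ}
    (hK : ∀ a : EuclideanSpace ℂ (Fin ℓ), a ≠ 0 →
      ∃ H : AddSubgroup (AddChar G ℂ), Nat.card H = K ∧
        symmetricSupport Wγ a ⊆ (H : Set (AddChar G ℂ)))
    {μ : VectorMeasure (TreePath m) (EuclideanSpace ℂ (Fin ℓ))}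
    (hμ : martingaleOf μ ∈ MartingaleSpace J (shiftInvariantSpace Wγ))
    (ν : Measure (TreePath m)) [IsFiniteMeasure ν]
    (hν : ∀ A, MeasurableSet A → ‖μ A‖ ≤ ν.real A) {ε : ℝ} (hε : 0 < ε) :
    ∃ δ > 0, ∀ (n : ℕ) (ω : Atom m n),
      (1 - δ) * ν.real (pathsThrough ω) < ‖μ (pathsThrough ω)‖ →
      ∀ k, ν.real (pathsThrough (son ω k)) ≤ (K / m + ε) * ν.real (pathsThrough ω) := by
  obtain ⟨δ, hδ, h⟩ := exists_pos_forall_le_of_norm_sum_gt hK hε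
  refine ⟨δ, hδ, fun n ω hω k => ?_⟩
  have hcard : Fintype.card G = m := by
    rw [Fintype.card_congr (J n ω), Fintype.card_fin]
  rw [hcard] at h
  have hm0 : (m : ℂ) ≠ 0 := Nat.cast_ne_zero.2 (by lia)
  set P := ν.real (pathsThrough ω) with hP
  have hPk : ν.real (pathsThrough (son ω k)) ≤ P := by
    rw [hP, ← iUnion_pathsThrough_son ω]
    exact measureReal_mono (Set.subset_iUnion (fun k => pathsThrough (son ω k)) k)
  rcases (show 0 ≤ P from measureReal_nonneg).eq_or_lt with hP0 | hP0
  · rw [← hP0, mul_zero]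
    exact hPk.trans_eq hP0.symm
  have hsumμ : ∑ g, μ (pathsThrough (son ω (J n ω g))) = μ (pathsThrough ω) := by
    rw [← sum_vectorMeasure_pathsThrough_son hm μ ω]
    exact (J n ω).sum_comp fun k => μ (pathsThrough (son ω k))
  have hsumν : ∑ g, ν.real (pathsThrough (son ω (J n ω g))) = P := by
    rw [hP, ← sum_measureReal_pathsThrough_son hm ν ω]
    exact (J n ω).sum_comp fun k => ν.real (pathsThrough (son ω k))
  -- This scalar removes the density factor `m ^ n` and normalizes the mass of `ω` to `1`.
  have hW := (shiftInvariantSpace Wγ).smul_mem ((P : ℂ)⁻¹ * ((m : ℂ) ^ n)⁻¹) (hμ.2 n ω)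
  have hres := h (fun g => (P : ℂ)⁻¹ • μ (pathsThrough (son ω (J n ω g))))
    (fun g => P⁻¹ * ν.real (pathsThrough (son ω (J n ω g)))) (fun g => ?_) ?_ ?_ ?_ ((J n ω).symm k)
  · simp only [Equiv.apply_symm_apply] at hres
    rwa [inv_mul_le_iff₀ hP0, mul_comm] at hres
  · rw [norm_smul, norm_inv, Complex.norm_of_nonneg hP0.le]
    exact mul_le_mul_of_nonneg_left (hν _ (measurableSet_pathsThrough hm _)) (by positivity)
  · rw [← Finset.mul_sum, hsumν, inv_mul_cancel₀ hP0.ne']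
  · convert hW using 1
    funext g
    rw [← Finset.smul_sum, hsumμ]
    simp only [Pi.smul_apply, differenceOn, martingaleOf, smul_sub, smul_smul]
    congr 2 <;> field_simp; ring
  · rw [← Finset.smul_sum, hsumμ, norm_smul, norm_inv, Complex.norm_of_nonneg hP0.le,
      lt_inv_mul_iff₀ hP0, mul_comm]
    exact hω

/-- The gap between the two sides serves as the `ε` of the stability estimate. For `K = 0` the left
side is `0`, whatever the value of `log 0`. -/
theorem div_lt_rpow_neg_of_lt {K : ℕ} (hm : 2 ≤ m) {s : ℝ}
    (hs : s < 1 - Real.log K / Real.log m) : (K / m : ℝ) < (m : ℝ) ^ (-s) := by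
  have hm' : (1 : ℝ) < m := by exact_mod_cast hm
  have hm0 : (0 : ℝ) < m := by positivity
  rcases Nat.eq_zero_or_pos K with h | h
  · simpa [h] using Real.rpow_pos_of_pos hm0 (-s)
  · have hK0 : (0 : ℝ) < K := by exact_mod_cast h
    have hlog := Real.log_pos hm'
    rw [← Real.log_lt_log_iff (by positivity) (by positivity), Real.log_rpow hm0,
      Real.log_div hK0.ne' hm0.ne']
    have h1 : Real.log K / Real.log m * Real.log m = Real.log K := div_mul_cancel₀ _ hlog.ne'
    nlinarith

end Mass

end RegularTree

/-! ### The dimension bound. -/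

open MeasureTheory Filter Topology RegularTree in
theorem mainTheorem5 (m : ℕ) (hm : 3 ≤ m) (ℓ : ℕ)
    {G : Type*} [AddCommGroup G] [Fintype G]
    (J : (n : ℕ) → RegularTree.Atom m n → (G ≃ Fin m))
    (Wγ : AddChar G ℂ → Submodule ℂ (EuclideanSpace ℂ (Fin ℓ)))
    (K : ℕ)
    (hK : ∀ a : EuclideanSpace ℂ (Fin ℓ), a ≠ 0 →
      ∃ H : AddSubgroup (AddChar G ℂ), Nat.card H = K ∧
        RegularTree.symmetricSupport Wγ a ⊆ (H : Set (AddChar G ℂ)))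
    (μ : MeasureTheory.VectorMeasure (RegularTree.TreePath m) (EuclideanSpace ℂ (Fin ℓ)))
    (hμ : RegularTree.martingaleOf μ ∈
      RegularTree.MartingaleSpace J (RegularTree.shiftInvariantSpace Wγ)) :
    ENNReal.ofReal (1 - Real.log K / Real.log m) ≤ RegularTree.lowerDimH μ := by
  have hm2 : 2 ≤ m := by lia
  refine le_sInf fun α ⟨F, hF, hμF, hdim⟩ => ?_
  by_contra! hα
  obtain ⟨s, hαs, hs⟩ := ENNReal.lt_iff_exists_nnreal_btwn.1 hα
  have hs0 : (0 : ℝ) < s := ENNReal.coe_pos.1 (bot_le.trans_lt hαs)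
  have hs1 : (s : ℝ) < 1 - Real.log K / Real.log m := by
    rw [← ENNReal.ofReal_coe_nnreal] at hs
    exact (ENNReal.ofReal_lt_ofReal_iff_of_nonneg s.2).1 hs
  have hH0 : μH[(s : ℝ)] F = 0 := hausdorffMeasure_of_dimH_lt (hdim.trans_lt hαs)
  obtain ⟨ν, u, hνfin, hum, hu1, hμu⟩ := exists_polar_decomposition μ
  have hui : Integrable u ν := (integrable_const (1 : ℝ)).mono' hum.aestronglyMeasurable
    (hu1.mono fun x hx => hx.le)
  have hν : ∀ A, MeasurableSet A → ‖μ A‖ ≤ ν.real A := fun A hA => by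
    rw [hμu A hA]
    refine (norm_integral_le_integral_norm _).trans_eq ?_
    rw [integral_congr_ae (ae_restrict_of_ae hu1)]
    simp
  -- With `ε = m ^ (-s) - K / m`, the factor `K / m + ε` is exactly `m ^ (-s)`.
  obtain ⟨δ, hδ, hson⟩ := exists_pos_forall_measureReal_son_le hm2 hK hμ ν hν
    (sub_pos.2 (div_lt_rpow_neg_of_lt hm2 hs1))
  simp only [add_sub_cancel] at hson
  have hae : ∀ᵐ x ∂ν, ∀ᶠ n in atTop, ν.real (pathsThrough (initialAtom (n + 1) x)) ≤
      (m : ℝ) ^ (-(s : ℝ)) * ν.real (pathsThrough (initialAtom n x)) := by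
    filter_upwards [hu1, exists_tendsto_average_atoms hm2 ν hui] with x hx ⟨c, hc, hcμ⟩
    have hlt : 1 - δ < ‖u x‖ := by linarith
    filter_upwards [hc.norm.eventually_const_lt hlt] with n hn
    rcases (measureReal_nonneg : 0 ≤ ν.real (pathsThrough (initialAtom n x))).eq_or_lt with h0 | h0
    · rw [← h0, mul_zero, h0]
      refine measureReal_mono fun y hy => ?_
      rw [initialAtom_succ, mem_pathsThrough, initialAtom_eq_son_iff] at hy
      exact mem_pathsThrough.2 hy.1
    · rw [initialAtom_succ]
      refine hson n _ ?_ _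
      rw [hμu _ (measurableSet_pathsThrough hm2 _), ← hcμ n, norm_smul, Real.norm_of_nonneg h0.le,
        mul_comm]
      exact mul_lt_mul_of_pos_left hn h0
  -- The level where decay begins depends on the path; splitting `F` by it makes `N` uniform on each
  -- piece.
  let A : ℕ → Set (TreePath m) := fun N => F ∩ ⋂ n ≥ N,
    {x | ν.real (pathsThrough (initialAtom (n + 1) x)) ≤
      (m : ℝ) ^ (-(s : ℝ)) * ν.real (pathsThrough (initialAtom n x))}
  have hmeas : ∀ n, Measurable fun x : TreePath m => ν.real (pathsThrough (initialAtom n x)) :=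
    fun n => (measurable_of_finite fun ω : Atom m n => ν.real (pathsThrough ω)).comp
      (measurable_initialAtom hm2 n)
  have hA : ∀ N, MeasurableSet (A N) := fun N =>
    hF.inter <| MeasurableSet.iInter fun n => MeasurableSet.iInter fun _ =>
      measurableSet_le (hmeas (n + 1)) ((hmeas n).const_mul _)
  have hA0 : ∀ N, ν (A N) = 0 := fun N =>
    measure_eq_zero_of_hausdorffMeasure_eq_zero hm2 ν (hA N) hs0 N
      (fun x hx n hn => Set.mem_iInter₂.1 hx.2 n hn)
      (measure_mono_null Set.inter_subset_left hH0)
  have hF0 : ν F = 0 := by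
    refine measure_mono_null_ae ?_ (measure_iUnion_null hA0)
    filter_upwards [hae] with x hx hxF
    obtain ⟨N, hN⟩ := eventually_atTop.1 hx
    exact Set.mem_iUnion.2 ⟨N, hxF, Set.mem_iInter₂.2 hN⟩
  refine hμF (norm_le_zero_iff.1 ((hν F hF).trans_eq ?_))
  simp [measureReal_def, hF0]
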